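/- Let $u\in\mathbb C$ with $\operatorname{Re}u>0$ and let $v>0$ be real. Then the Laurent series $$\Psi(u,v,z)=\sum_{n\in\mathbb Z}\Gamma\!\left(u+\frac{2ivn}{\pi}\right)z^n$$ converges absolutely at every point of the annulus $\mathcal C_v=\{z\in\mathbb C: e^{-v}<|z|<e^{v}\}$, its sum is analytic in $\mathcal C_v$, and the boundary $\partial\mathcal C_v=\{|z|=e^{-v}\}\cup\{|z|=e^{v}\}$ is a natural boundary of this sum: for no point $z_0\in\partial\mathcal C_v$ do there exist an open neighbourhood $U$ of $z_0$ and an analytic function $g$ on $U$ with $g(z)=\Psi(u,v,z)$ for all $z\in U\cap\mathcal C_v$. In particular, the sum extends analytically across no arc of either circle. -/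

import Mathlib

/-- The `n`-th term `Γ(u + 2ivn/π) zⁿ` of the Laurent series. -/
noncomputable def psiTerm (u : ℂ) (v : ℝ) (z : ℂ) (n : ℤ) : ℂ :=
  Complex.Gamma (u + 2 * Complex.I * (v : ℂ) * (n : ℂ) / (Real.pi : ℂ)) * z ^ n

/-- `Ψ(u, v, z) = ∑_{n ∈ ℤ} Γ(u + 2ivn/π) zⁿ`. -/
noncomputable def Psi (u : ℂ) (v : ℝ) (z : ℂ) : ℂ :=
  ∑' n : ℤ, psiTerm u v z n

/-- The annulus `e^{-|v|} < |z| < e^{|v|}`. -/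
def annulusC (v : ℝ) : Set ℂ :=
  {z : ℂ | Real.exp (-|v|) < ‖z‖ ∧ ‖z‖ < Real.exp |v|}

/-- `f`, given on `D`, extends analytically across the boundary point `z₀`: on some open
neighbourhood of `z₀` there is an analytic function that coincides with `f` on the part of the
neighbourhood lying in `D`. -/
def ExtendsAnalyticallyAt (f : ℂ → ℂ) (D : Set ℂ) (z₀ : ℂ) : Prop :=
  ∃ U : Set ℂ, IsOpen U ∧ z₀ ∈ U ∧
    ∃ g : ℂ → ℂ, AnalyticOnNhd ℂ g U ∧ Set.EqOn g f (U ∩ D)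

/-- The topological boundary of `D` is a natural boundary for `f`: the function `f` is analytic
in `D` and extends analytically across no boundary point of `D`. -/
def HasNaturalBoundary (f : ℂ → ℂ) (D : Set ℂ) : Prop :=
  AnalyticOnNhd ℂ f D ∧ ∀ z₀ ∈ frontier D, ¬ ExtendsAnalyticallyAt f D z₀

/-!
The proof transforms the Laurent series into a Dirichlet series with Hadamard gaps.

Rotating the integral for `Γ` to a ray of argument `± α` (`exists_norm_Gamma_le_exp`) shows that
`Γ` decays on vertical lines like `exp (-α |Im a|)` for every `α < π / 2`. This gives absolute and
locally uniform convergence in the annulus.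

Put `T = π² / v`. Every point of the annulus is `z = exp (-(2v/π) i log x)` with `Re x > 0`, and
`x ^ (-u) * Γ (u + 2ivn/π) zⁿ` is, up to the factor `T`, the `n`-th Fourier coefficient
of the `1`-periodization of `s ↦ exp (-u T s - x exp (-T s))`. Hence Poisson summation
(`Psi_eq_tsum_gapTerm`) gives
`Ψ(u, v, z) = T x ^ u ∑ₖ exp (u T k) exp (-x exp (T k))`, the sum being over `k ∈ ℤ`.
The boundary circles correspond to the two halves of the imaginary axis in `x`.

The frequencies `λₖ = exp (T k)` on the right grow geometrically, while the coefficients are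
unbounded because `Re u > 0`. If the sum were bounded near `i y₀`, integrate it along
`Re x = r` against `φ (y) exp (i λₖ y)`, with `φ` a smooth bump at `y₀`. The term of index `j` gets
the factor `𝓕 φ ((λⱼ - λₖ) / 2π)`, and since `|λⱼ - λₖ| ≥ (1 - exp (-T)) λⱼ` for `j ≠ k`, the rapid
decay of `𝓕 φ` bounds the sum of all these terms uniformly in `k` and `r`
(`exists_offDiagonal_bound`). So `|exp (u T k)| |∫ φ|` would be bounded in `k`, which is absurd
(`not_eventually_norm_tsum_gapTerm_le`). An analytic extension across a boundary point is bounded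
near that point, so there is none.
-/

open Filter Topology MeasureTheory
open scoped FourierTransform SchwartzMap ContDiff

/-! ### The Gamma function on vertical lines -/

lemma integrableOn_rpow_sub_one_mul_exp_neg {σ c : ℝ} (hσ : 0 < σ) (hc : 0 < c) :
    IntegrableOn (fun t : ℝ => t ^ (σ - 1) * Real.exp (-(c * t))) (Set.Ioi 0) := by
  simpa using integrableOn_rpow_mul_exp_neg_mul_rpow (p := 1) (s := σ - 1) (b := c)
    (by linarith) one_pos hc

lemma norm_cpow_sub_one_mul_exp (a r : ℂ) {t : ℝ} (ht : 0 < t) :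
    ‖(t : ℂ) ^ (a - 1) * Complex.exp (-(r * t))‖
      = t ^ (a.re - 1) * Real.exp (-(r.re * t)) := by
  rw [norm_mul, Complex.norm_cpow_eq_rpow_re_of_pos ht, Complex.norm_exp]
  simp

lemma aestronglyMeasurable_cpow_mul_exp (a r : ℂ) :
    AEStronglyMeasurable (fun t : ℝ => (t : ℂ) ^ a * Complex.exp (-(r * t)))
      (volume.restrict (Set.Ioi 0)) := by
  refine ContinuousOn.aestronglyMeasurable (fun t ht => ?_) measurableSet_Ioi
  have h : ContinuousAt (fun t : ℝ => (t : ℂ) ^ a) t :=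
    Complex.continuousAt_ofReal_cpow_const t a (Or.inr (ne_of_gt ht))
  exact (h.mul (by fun_prop)).continuousWithinAt

lemma differentiableOn_laplace_cpow {a : ℂ} (ha : 0 < a.re) :
    DifferentiableOn ℂ
      (fun r : ℂ => ∫ t : ℝ in Set.Ioi 0, (t : ℂ) ^ (a - 1) * Complex.exp (-(r * t)))
      {r : ℂ | 0 < r.re} := by
  intro r hr
  have hr : 0 < r.re := hr
  have hs : {w : ℂ | r.re / 2 < w.re} ∈ 𝓝 r :=
    (isOpen_lt continuous_const Complex.continuous_re).mem_nhds
      (by change r.re / 2 < r.re; linarith)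
  have key := hasDerivAt_integral_of_dominated_loc_of_deriv_le
    (μ := volume.restrict (Set.Ioi (0 : ℝ)))
    (F := fun (r : ℂ) (t : ℝ) => (t : ℂ) ^ (a - 1) * Complex.exp (-(r * t)))
    (F' := fun (r : ℂ) (t : ℝ) => (t : ℂ) ^ (a - 1) * (Complex.exp (-(r * t)) * (-(t : ℂ))))
    (bound := fun t : ℝ => t ^ (a.re + 1 - 1) * Real.exp (-(r.re / 2 * t)))
    hs (Eventually.of_forall fun w => aestronglyMeasurable_cpow_mul_exp _ _) ?_ ?_ ?_
    (integrableOn_rpow_sub_one_mul_exp_neg (by linarith) (by linarith)) ?_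
  · exact key.2.differentiableAt.differentiableWithinAt
  · refine (integrableOn_rpow_sub_one_mul_exp_neg ha hr).mono'
      (aestronglyMeasurable_cpow_mul_exp _ _) ?_
    filter_upwards [ae_restrict_mem measurableSet_Ioi] with t ht
    exact (norm_cpow_sub_one_mul_exp a r ht).le
  · have h := (aestronglyMeasurable_cpow_mul_exp (a - 1) r).mul
      (Continuous.aestronglyMeasurable (f := fun t : ℝ => -(t : ℂ)) (by fun_prop))
    exact h.congr (Eventually.of_forall fun t => by simp [mul_assoc])
  · filter_upwards [ae_restrict_mem measurableSet_Ioi] with t ht w hw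
    have ht : 0 < t := ht
    have hw : r.re / 2 < w.re := hw
    rw [← mul_assoc, norm_mul, norm_cpow_sub_one_mul_exp a w ht, norm_neg,
      Complex.norm_of_nonneg ht.le, add_sub_right_comm, Real.rpow_add_one ht.ne', mul_right_comm]
    gcongr
  · filter_upwards with t w _
    refine HasDerivAt.const_mul _ (HasDerivAt.cexp ?_)
    exact (hasDerivAt_mul_const (t : ℂ)).fun_neg

/-- The Mellin transform of `t ↦ exp (-r t)` for complex `r` in the right half-plane; it follows
from the case of real `r` by the identity theorem. -/
lemma integral_cpow_mul_exp_neg_mul_of_re_pos {a r : ℂ} (ha : 0 < a.re) (hr : 0 < r.re) :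
    ∫ t : ℝ in Set.Ioi 0, (t : ℂ) ^ (a - 1) * Complex.exp (-(r * t))
      = Complex.exp (-(Complex.log r * a)) * Complex.Gamma a := by
  have hopen : IsOpen {r : ℂ | 0 < r.re} := isOpen_lt continuous_const Complex.continuous_re
  have h1 := (differentiableOn_laplace_cpow ha).analyticOnNhd hopen
  have h2 : AnalyticOnNhd ℂ (fun r : ℂ => Complex.exp (-(Complex.log r * a)) * Complex.Gamma a)
      {r : ℂ | 0 < r.re} := by
    refine DifferentiableOn.analyticOnNhd (fun w hw => ?_) hopen
    have : DifferentiableAt ℂ Complex.log w := Complex.differentiableAt_log (Or.inl hw)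
    exact DifferentiableAt.differentiableWithinAt (by fun_prop)
  refine h1.eqOn_of_preconnected_of_frequently_eq h2
    (convex_halfSpace_re_gt 0).isPreconnected (z₀ := 1) (by simp) ?_ hr
  have hreal : ∀ x : ℝ, 0 < x →
      ∫ t : ℝ in Set.Ioi 0, (t : ℂ) ^ (a - 1) * Complex.exp (-((x : ℂ) * t))
        = Complex.exp (-(Complex.log x * a)) * Complex.Gamma a := by
    intro x hx
    have hx' : (x : ℂ) ≠ 0 := by exact_mod_cast hx.ne'
    rw [Complex.integral_cpow_mul_exp_neg_mul_Ioi ha hx, one_div,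
      Complex.cpow_def_of_ne_zero (inv_ne_zero hx'), Complex.log_inv, neg_mul]
    rw [Complex.arg_ofReal_of_nonneg hx.le]
    exact Real.pi_pos.ne
  have ht : Tendsto (fun x : ℝ => (x : ℂ)) (𝓝[≠] 1) (𝓝[≠] (1 : ℂ)) := by
    refine tendsto_nhdsWithin_of_tendsto_nhds_of_eventually_within _ ?_ ?_
    · exact (Complex.continuous_ofReal.tendsto' 1 1 (by simp)).mono_left nhdsWithin_le_nhds
    · filter_upwards [self_mem_nhdsWithin] with x hx
      simpa using hx
  refine ht.frequently (Eventually.frequently ?_)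
  have : ∀ᶠ x : ℝ in 𝓝[≠] 1, 0 < x := nhdsWithin_le_nhds (lt_mem_nhds one_pos)
  filter_upwards [this] with x hx using hreal x hx

/-- Exponential decay of `Γ` on vertical lines with any rate below `π / 2`: rotate the integral
defining `Γ` to the rays of argument `± α`. -/
lemma exists_norm_Gamma_le_exp {σ α : ℝ} (hσ : 0 < σ) (hα0 : 0 ≤ α) (hα : α < Real.pi / 2) :
    ∃ C : ℝ, ∀ a : ℂ, a.re = σ → ‖Complex.Gamma a‖ ≤ C * Real.exp (-(α * |a.im|)) := by
  refine ⟨∫ t : ℝ in Set.Ioi 0, t ^ (σ - 1) * Real.exp (-(Real.cos α * t)), ?_⟩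
  rintro a rfl
  have main : ∀ β : ℝ, |β| = α → ‖Complex.Gamma a‖ * Real.exp (β * a.im)
      ≤ ∫ t : ℝ in Set.Ioi 0, t ^ (a.re - 1) * Real.exp (-(Real.cos α * t)) := by
    intro β hβ
    have hre : (Complex.exp (β * Complex.I)).re = Real.cos α := by
      rw [Complex.exp_ofReal_mul_I_re, ← hβ, Real.cos_abs]
    have hpos : 0 < Real.cos α :=
      Real.cos_pos_of_mem_Ioo ⟨by linarith [Real.pi_pos], hα⟩
    have hβ' := abs_le.1 hβ.le
    have hlog : Complex.log (Complex.exp (β * Complex.I)) = β * Complex.I :=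
      Complex.log_exp (by simp; linarith [Real.pi_pos]) (by simp; linarith [Real.pi_pos])
    have h := integral_cpow_mul_exp_neg_mul_of_re_pos (r := Complex.exp (β * Complex.I)) hσ
      (by rw [hre]; exact hpos)
    have h3 : ‖Complex.exp (-(β * Complex.I * a)) * Complex.Gamma a‖
        = ‖Complex.Gamma a‖ * Real.exp (β * a.im) := by
      rw [norm_mul, Complex.norm_exp, mul_comm]
      simp
    rw [hlog] at h
    rw [← h3, ← h]
    refine norm_integral_le_of_norm_le (integrableOn_rpow_sub_one_mul_exp_neg hσ hpos) ?_
    filter_upwards [ae_restrict_mem measurableSet_Ioi] with t ht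
    rw [norm_cpow_sub_one_mul_exp a _ ht, hre]
  rw [Real.exp_neg, ← div_eq_mul_inv, le_div_iff₀ (Real.exp_pos _)]
  rcases le_total 0 a.im with h | h
  · rw [abs_of_nonneg h]
    exact main α (abs_of_nonneg hα0)
  · rw [abs_of_nonpos h, mul_neg, ← neg_mul]
    exact main (-α) (by rw [abs_neg, abs_of_nonneg hα0])

/-! ### Two-sided exponential sums -/

lemma summable_exp_neg_mul_abs_int {c : ℝ} (hc : 0 < c) :
    Summable fun n : ℤ => Real.exp (-(c * |(n : ℝ)|)) := by
  have h : Summable fun n : ℕ => Real.exp (-(c * (n : ℝ))) := by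
    have := Real.summable_exp_nat_mul_iff.2 (neg_lt_zero.2 hc)
    simpa [mul_comm] using this
  exact Summable.of_nat_of_neg (by simpa using h) (by simpa using h)

/-- The Gamma integrand in logarithmic coordinates; for `σ > 0` the bound is exponential decay in
both directions. -/
lemma exists_exp_mul_sub_exp_le (σ : ℝ) {r : ℝ} (hr : 0 < r) :
    ∃ C : ℝ, ∀ s : ℝ,
      Real.exp (σ * s - r * Real.exp s) ≤ C * Real.exp (-(σ * |s|)) := by
  have h := (tendsto_rpow_mul_exp_neg_mul_atTop_nhds_zero (2 * σ) r hr)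
  have hcont : Continuous fun s : ℝ => Real.exp (2 * σ * s - r * Real.exp s) := by fun_prop
  have ht : Tendsto (fun s : ℝ => Real.exp (2 * σ * s - r * Real.exp s)) atTop (𝓝 0) := by
    refine (h.comp Real.tendsto_exp_atTop).congr fun s => ?_
    rw [Function.comp_apply, ← Real.exp_mul, ← Real.exp_add]
    ring_nf
  obtain ⟨S, hS⟩ := eventually_atTop.1 (ht.eventually (ge_mem_nhds one_pos))
  obtain ⟨K, hK⟩ := (isCompact_Icc (a := (0 : ℝ)) (b := S)).bddAbove_image hcont.continuousOn
  refine ⟨max 1 K, fun s => ?_⟩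
  rcases le_total 0 s with hs | hs
  · rw [abs_of_nonneg hs, Real.exp_neg, ← div_eq_mul_inv, le_div_iff₀ (Real.exp_pos _),
      ← Real.exp_add, show σ * s - r * Real.exp s + σ * s = 2 * σ * s - r * Real.exp s by ring]
    rcases le_total S s with h1 | h1
    · exact (hS s h1).trans (le_max_left _ _)
    · exact (hK ⟨s, ⟨hs, h1⟩, rfl⟩).trans (le_max_right _ _)
  · rw [abs_of_nonpos hs, mul_neg, neg_neg]
    calc Real.exp (σ * s - r * Real.exp s) ≤ Real.exp (σ * s) :=
          Real.exp_le_exp.2 (by linarith [mul_pos hr (Real.exp_pos s)])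
      _ ≤ max 1 K * Real.exp (σ * s) :=
          le_mul_of_one_le_left (Real.exp_pos _).le (le_max_left _ _)

/-! ### Dirichlet series with geometrically growing frequencies -/

lemma one_sub_exp_neg_mul_exp_le_abs_sub {T : ℝ} (hT : 0 < T) {j k : ℤ} (hjk : j ≠ k) :
    (1 - Real.exp (-T)) * Real.exp (T * j) ≤ |Real.exp (T * j) - Real.exp (T * k)| := by
  have hj := Real.exp_pos (T * j)
  have hT1 : Real.exp (-T) < 1 := by simpa using hT
  rcases lt_or_gt_of_ne hjk with h | h
  · have h1 : (j : ℝ) + 1 ≤ k := by exact_mod_cast h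
    have h2 : Real.exp (T * j) ≤ Real.exp (-T) * Real.exp (T * k) := by
      rw [← Real.exp_add]
      exact Real.exp_le_exp.2 (by nlinarith)
    have h4 : Real.exp (T * j) ≤ Real.exp (T * k) :=
      Real.exp_le_exp.2 (by nlinarith)
    have h5 : (1 - Real.exp (-T)) * Real.exp (T * j) ≤ (1 - Real.exp (-T)) * Real.exp (T * k) :=
      mul_le_mul_of_nonneg_left h4 (by linarith)
    rw [abs_sub_comm]
    refine le_trans ?_ (le_abs_self _)
    linarith
  · have h1 : (k : ℝ) + 1 ≤ j := by exact_mod_cast h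
    have h2 : Real.exp (T * k) ≤ Real.exp (-T) * Real.exp (T * j) := by
      rw [← Real.exp_add]
      exact Real.exp_le_exp.2 (by nlinarith)
    refine le_trans ?_ (le_abs_self _)
    linarith

/-- A smooth bump near `y₀`, as a Schwartz function, with non-vanishing integral. -/
lemma exists_schwartz_bump (y₀ : ℝ) {δ : ℝ} (hδ : 0 < δ) :
    ∃ φ : 𝓢(ℝ, ℂ), (∀ y, φ y ≠ 0 → |y - y₀| < δ) ∧ ∫ y, φ y ≠ 0 := by
  let f : ContDiffBump y₀ := ⟨δ / 2, δ, by linarith, by linarith⟩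
  have h1 : HasCompactSupport fun y : ℝ => ((f y : ℝ) : ℂ) := 
    f.hasCompactSupport.comp_left (g := fun t : ℝ => (t : ℂ)) Complex.ofReal_zero
  have h2 : ContDiff ℝ ∞ fun y : ℝ => ((f y : ℝ) : ℂ) := Complex.ofRealCLM.contDiff.comp f.contDiff
  refine ⟨h1.toSchwartzMap h2, fun y hy => ?_, ?_⟩
  · have hy : f y ≠ 0 := by simpa using hy
    have : y ∈ Function.support f := hy
    rw [f.support_eq, Metric.mem_ball, Real.dist_eq] at this
    exact this
  · simp only [HasCompactSupport.toSchwartzMap_toFun]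
    rw [integral_complex_ofReal]
    exact_mod_cast (f.integral_pos (μ := volume)).ne'

lemma SchwartzMap.exists_fourier_le (φ : 𝓢(ℝ, ℂ)) (N : ℕ) :
    ∃ C : ℝ, 0 ≤ C ∧ ∀ ξ : ℝ, ‖𝓕 (φ : ℝ → ℂ) ξ‖ ≤ C ∧ |ξ| ^ N * ‖𝓕 (φ : ℝ → ℂ) ξ‖ ≤ C := by
  obtain ⟨C₀, h₀, hC₀⟩ := (𝓕 φ).decay 0 0
  obtain ⟨C₁, h₁, hC₁⟩ := (𝓕 φ).decay N 0
  refine ⟨max C₀ C₁, h₀.le.trans (le_max_left _ _), fun ξ => ⟨?_, ?_⟩⟩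
  · refine le_trans ?_ (le_max_left _ _)
    simpa [SchwartzMap.fourier_coe] using hC₀ ξ
  · refine le_trans ?_ (le_max_right _ _)
    simpa [SchwartzMap.fourier_coe] using hC₁ ξ

/-- The off-diagonal terms are dominated by a summable family that does not depend on the
frequency `exp (T k)` which is picked out. -/
lemma exists_offDiagonal_bound (φ : 𝓢(ℝ, ℂ)) (σ : ℝ) {T : ℝ} (hT : 0 < T) :
    ∃ C : ℝ, 0 ≤ C ∧ ∀ j k : ℤ, j ≠ k →
      Real.exp (σ * (T * j)) *
          ‖𝓕 (φ : ℝ → ℂ) ((Real.exp (T * j) - Real.exp (T * k)) / (2 * Real.pi))‖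
        ≤ C * Real.exp (-(σ * T * |(j : ℝ)|)) := by
  -- With `N ≥ 2σ`, a decay of order `N` turns the growth `exp (σ T j)` into `exp (-σ T j)`.
  obtain ⟨N, hN⟩ := exists_nat_ge (2 * σ)
  obtain ⟨C, hC0, hC⟩ := φ.exists_fourier_le N
  have hT1 : Real.exp (-T) < 1 := by simpa using hT
  set d : ℝ := (1 - Real.exp (-T)) / (2 * Real.pi) with hd
  have hd0 : 0 < d := div_pos (by linarith) (by positivity)
  refine ⟨max C (C / d ^ N), le_max_of_le_left hC0, fun j k hjk => ?_⟩
  set ξ := (Real.exp (T * j) - Real.exp (T * k)) / (2 * Real.pi) with hξ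
  rcases le_total (j : ℝ) 0 with hj | hj
  · rw [abs_of_nonpos hj, mul_comm]
    refine mul_le_mul ((hC ξ).1.trans (le_max_left _ _)) ?_ (Real.exp_pos _).le
      (le_max_of_le_left hC0)
    exact Real.exp_le_exp.2 (le_of_eq (by ring))
  · have h1 : d * Real.exp (T * j) ≤ |ξ| := by
      rw [hξ, abs_div, abs_of_pos (by positivity : (0 : ℝ) < 2 * Real.pi), hd, div_mul_eq_mul_div]
      gcongr
      exact one_sub_exp_neg_mul_exp_le_abs_sub hT hjk
    have h2 : (d * Real.exp (T * j)) ^ N * ‖𝓕 (φ : ℝ → ℂ) ξ‖ ≤ C :=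
      le_trans (by gcongr) (hC ξ).2
    have h3 : Real.exp (T * j) ^ N * ‖𝓕 (φ : ℝ → ℂ) ξ‖ ≤ C / d ^ N := by
      rw [le_div_iff₀ (by positivity)]
      rw [mul_pow] at h2
      linarith
    rw [abs_of_nonneg hj]
    have h4 : Real.exp (σ * (T * j))
        ≤ Real.exp (-(σ * T * j)) * Real.exp (T * j) ^ N := by
      rw [← Real.exp_nat_mul, ← Real.exp_add]
      apply Real.exp_le_exp.2
      have := mul_le_mul_of_nonneg_right hN (mul_nonneg hT.le hj)
      linarith
    calc _ ≤ Real.exp (-(σ * T * j)) * Real.exp (T * j) ^ N * ‖𝓕 (φ : ℝ → ℂ) ξ‖ := by gcongr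
      _ = (Real.exp (T * j) ^ N * ‖𝓕 (φ : ℝ → ℂ) ξ‖) * Real.exp (-(σ * T * j)) := by ring
      _ ≤ _ := by
        gcongr
        exact h3.trans (le_max_right _ _)

/-- The `k`-th term of the Dirichlet series `∑ₖ exp (u T k) exp (-x exp (T k))`, whose frequencies
`exp (T k)`, `k ∈ ℤ`, form a geometric progression. -/
noncomputable def gapTerm (u : ℂ) (T : ℝ) (x : ℂ) (k : ℤ) : ℂ :=
  Complex.exp (u * (T * k) - x * Complex.exp (T * k))

lemma norm_gapTerm (u : ℂ) (T : ℝ) (x : ℂ) (k : ℤ) :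
    ‖gapTerm u T x k‖ = Real.exp (u.re * (T * k) - x.re * Real.exp (T * k)) := by
  have h1 : (T : ℂ) * k = ((T * k : ℝ) : ℂ) := by push_cast; rfl
  rw [gapTerm, Complex.norm_exp, h1, ← Complex.ofReal_exp, Complex.sub_re, Complex.re_mul_ofReal,
    Complex.re_mul_ofReal]

lemma summable_exp_gap {σ T r : ℝ} (hσ : 0 < σ) (hT : 0 < T) (hr : 0 < r) :
    Summable fun k : ℤ => Real.exp (σ * (T * k) - r * Real.exp (T * k)) := by
  obtain ⟨C, hC⟩ := exists_exp_mul_sub_exp_le σ hr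
  refine Summable.of_nonneg_of_le (fun k => (Real.exp_pos _).le) (fun k => hC (T * k)) ?_
  refine (((summable_exp_neg_mul_abs_int (mul_pos hσ hT))).mul_left C).congr fun k => ?_
  rw [abs_mul, abs_of_pos hT, mul_assoc]

/-- Integrating the series along a vertical line against `φ (y) exp (i exp (T k) y)` term by term
produces the Fourier transform of `φ` at the differences of frequencies. -/
lemma hasSum_integral_gapTerm (φ : 𝓢(ℝ, ℂ)) {u : ℂ} {T r : ℝ} (hu : 0 < u.re) (hT : 0 < T)
    (hr : 0 < r) (k : ℤ) :
    HasSum (fun j : ℤ => gapTerm u T r j *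
        𝓕 (φ : ℝ → ℂ) ((Real.exp (T * j) - Real.exp (T * k)) / (2 * Real.pi)))
      (∫ y : ℝ, (∑' j : ℤ, gapTerm u T (r + y * Complex.I) j) *
        (φ y * Complex.exp ((Real.exp (T * k) * y : ℝ) * Complex.I))) := by
  set ψ : ℝ → ℂ := fun y => φ y * Complex.exp ((Real.exp (T * k) * y : ℝ) * Complex.I) with hψ
  have hψn : ∀ y, ‖ψ y‖ = ‖φ y‖ := fun y => by
    rw [hψ, norm_mul, Complex.norm_exp_ofReal_mul_I, mul_one]
  have hnorm : ∀ (j : ℤ) (y : ℝ), ‖gapTerm u T (r + y * Complex.I) j * ψ y‖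
      = Real.exp (u.re * (T * j) - r * Real.exp (T * j)) * ‖φ y‖ := fun j y => by
    rw [norm_mul, norm_gapTerm, hψn]
    simp
  have hint : ∀ j : ℤ, Integrable fun y : ℝ => gapTerm u T (r + y * Complex.I) j * ψ y := by
    intro j
    refine ((φ.integrable (μ := volume)).norm.const_mul
      (Real.exp (u.re * (T * j) - r * Real.exp (T * j)))).mono' ?_
      (Eventually.of_forall fun y => (hnorm j y).le)
    have hφ := φ.continuous
    unfold gapTerm
    exact Continuous.aestronglyMeasurable (by fun_prop)
  have h := hasSum_integral_of_summable_integral_norm hint (by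
    simp_rw [hnorm, integral_const_mul]
    exact (summable_exp_gap hu hT hr).mul_right _)
  simp_rw [tsum_mul_right] at h
  convert! h using 2 with j
  rw [Real.fourier_real_eq_integral_exp_smul, ← integral_const_mul]
  congr 1
  ext y
  have hpi : (Real.pi : ℂ) ≠ 0 := by exact_mod_cast Real.pi_pos.ne'
  simp only [hψ]
  have e : gapTerm u T r j * Complex.exp ((-2 * Real.pi * y *
        ((Real.exp (T * j) - Real.exp (T * k)) / (2 * Real.pi)) : ℝ) * Complex.I)
      = gapTerm u T (r + y * Complex.I) j *
        Complex.exp ((Real.exp (T * k) * y : ℝ) * Complex.I) := by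
    rw [gapTerm, gapTerm, ← Complex.exp_add, ← Complex.exp_add]
    congr 1
    push_cast
    field_simp
    ring
  rw [smul_eq_mul]
  linear_combination φ y * e

/-- A Hadamard gap phenomenon: the series is unbounded near every point of the imaginary axis. If
it were bounded by `M` near `i y₀`, testing it against `φ (y) exp (i exp (T k) y)` with a bump `φ`
around `y₀` would bound the coefficient `exp (u T k)` independently of `k`, because the gaps make
the other terms negligible. -/
theorem not_eventually_norm_tsum_gapTerm_le {u : ℂ} {T : ℝ} (hu : 0 < u.re) (hT : 0 < T)
    (y₀ M : ℝ) :
    ¬ ∀ᶠ x in 𝓝 (y₀ * Complex.I : ℂ), 0 < x.re → ‖∑' k : ℤ, gapTerm u T x k‖ ≤ M := by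
  intro hM
  obtain ⟨δ, hδ, hball⟩ := Metric.eventually_nhds_iff.1 hM
  obtain ⟨φ, hφs, hφ0⟩ := exists_schwartz_bump y₀ (half_pos hδ)
  obtain ⟨C, hC0, hC⟩ := exists_offDiagonal_bound φ u.re hT
  set b : ℤ → ℝ := fun j => C * Real.exp (-(u.re * T * |(j : ℝ)|)) with hb
  have hbs : Summable b := (summable_exp_neg_mul_abs_int (mul_pos hu hT)).mul_left C
  have hb0 : ∀ j, 0 ≤ b j := fun j => mul_nonneg hC0 (Real.exp_pos _).le
  set K : ℝ := M * (∫ y, ‖φ y‖) + ∑' j, b j with hK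
  set A : ℝ := ‖∫ y, φ y‖ with hA
  have hA0 : 0 < A := norm_pos_iff.2 hφ0
  have hF0 : 𝓕 (φ : ℝ → ℂ) 0 = ∫ y, φ y := by
    simp [Real.fourier_real_eq_integral_exp_smul]
  have step : ∀ (k : ℤ) (r : ℝ), 0 < r → r < δ / 2 →
      Real.exp (u.re * (T * k) - r * Real.exp (T * k)) * A ≤ K := by
    intro k r hr hrδ
    have hsum := hasSum_integral_gapTerm φ hu hT hr k
    set F : ℤ → ℂ := fun j => gapTerm u T r j *
        𝓕 (φ : ℝ → ℂ) ((Real.exp (T * j) - Real.exp (T * k)) / (2 * Real.pi)) with hF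
    have hFk : ‖F k‖ = Real.exp (u.re * (T * k) - r * Real.exp (T * k)) * A := by
      rw [hF]
      simp only [sub_self, zero_div]
      rw [norm_mul, norm_gapTerm, hF0, Complex.ofReal_re]
    -- `F` with its diagonal term removed is dominated by `b`.
    have hoff : ∀ j, ‖Function.update F k 0 j‖ ≤ b j := by
      intro j
      by_cases hjk : j = k
      · simp [hjk, hb0]
      · rw [Function.update_of_ne hjk, hF]
        refine le_trans ?_ (hC j k hjk)
        rw [norm_mul, norm_gapTerm, Complex.ofReal_re]
        gcongr
        linarith [mul_pos hr (Real.exp_pos (T * j))]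
    have hup := (hsum.update k 0).tsum_eq
    have h1 := tsum_of_norm_bounded hbs.hasSum hoff
    rw [hup, zero_sub] at h1
    have h2 : ‖∫ y : ℝ, (∑' j : ℤ, gapTerm u T (r + y * Complex.I) j) *
        (φ y * Complex.exp ((Real.exp (T * k) * y : ℝ) * Complex.I))‖ ≤ M * ∫ y, ‖φ y‖ := by
      rw [← integral_const_mul]
      refine norm_integral_le_of_norm_le (φ.integrable.norm.const_mul M)
        (Eventually.of_forall fun y => ?_)
      rw [norm_mul, norm_mul, Complex.norm_exp_ofReal_mul_I, mul_one]
      by_cases hy : φ y = 0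
      · simp [hy]
      · refine mul_le_mul_of_nonneg_right (hball ?_ (by simpa using hr)) (norm_nonneg _)
        have hd : ((r : ℂ) + y * Complex.I) - y₀ * Complex.I
            = (r : ℂ) + ((y - y₀ : ℝ) : ℂ) * Complex.I := by push_cast; ring
        rw [dist_eq_norm, hd]
        calc _ ≤ ‖(r : ℂ)‖ + ‖((y - y₀ : ℝ) : ℂ) * Complex.I‖ := norm_add_le _ _
          _ = r + |y - y₀| := by
            rw [norm_mul, Complex.norm_I, mul_one, Complex.norm_real, Complex.norm_real,
              Real.norm_eq_abs, Real.norm_eq_abs, abs_of_pos hr]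
          _ < δ := by linarith [hφs y hy]
    rw [← hFk, hK]
    refine le_trans ?_ (add_le_add h2 h1)
    refine le_trans (le_of_eq ?_) (norm_sub_le _ _)
    rw [sub_add_cancel_right, neg_neg]
  -- The bound is uniform in `r`, so the damping factor disappears as `r` tends to `0`.
  have lim : ∀ k : ℤ, Real.exp (u.re * (T * k)) * A ≤ K := by
    intro k
    have hc : Continuous fun r : ℝ => Real.exp (u.re * (T * k) - r * Real.exp (T * k)) * A := by
      fun_prop
    have ht := (hc.tendsto' 0 (Real.exp (u.re * (T * k)) * A) (by simp)).mono_left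
      (nhdsWithin_le_nhds (s := Set.Ioi 0))
    refine le_of_tendsto ht ?_
    filter_upwards [Ioo_mem_nhdsGT (half_pos hδ)] with r hr using step k r hr.1 hr.2
  have hgrow : Tendsto (fun n : ℕ => Real.exp (u.re * (T * ((n : ℤ) : ℝ))) * A) atTop atTop := by
    refine Tendsto.atTop_mul_const hA0 (Real.tendsto_exp_atTop.comp ?_)
    simpa using (tendsto_natCast_atTop_atTop.const_mul_atTop hT).const_mul_atTop hu
  obtain ⟨n, hn⟩ := (hgrow.eventually (eventually_gt_atTop K)).exists
  exact absurd (lim n) (not_le.2 hn)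

/-! ### Poisson summation -/

lemma mellin_eq_integral_exp (f : ℝ → ℂ) (a : ℂ) :
    mellin f a = ∫ y : ℝ, Complex.exp (-(a * y)) * f (Real.exp (-y)) := by
  rw [mellin_eq_fourier, Real.fourier_real_eq_integral_exp_smul]
  congr 1
  ext y
  have hpi : (Real.pi : ℂ) ≠ 0 := by exact_mod_cast Real.pi_pos.ne'
  rw [Complex.real_smul, smul_eq_mul, ← mul_assoc, Complex.ofReal_exp, ← Complex.exp_add]
  congr 2
  nth_rewrite 3 [← Complex.re_add_im a]
  push_cast
  field_simp
  ring

lemma isBigO_exp_neg_mul_abs_rpow {c : ℝ} (hc : 0 < c) (b : ℝ) :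
    (fun s : ℝ => Real.exp (-(c * |s|))) =O[cocompact ℝ] fun s : ℝ => |s| ^ b := by
  have h := ((isLittleO_exp_neg_mul_rpow_atTop hc b).isBigO).comp_tendsto
    (tendsto_norm_cocompact_atTop (E := ℝ))
  simpa [Function.comp_def] using h

/-- A point `x` of the right half-plane gives the point `exp (-(2v/π) i log x)` of the annulus, and
the terms of the Laurent series there are Fourier coefficients of the function
`s ↦ exp (-u T s - x exp (-T s))`, where `T = π² / v`. -/
lemma fourier_gap_eq_psiTerm {u x : ℂ} {v : ℝ} (hu : 0 < u.re) (hv : 0 < v) (hx : 0 < x.re)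
    (n : ℤ) :
    𝓕 (fun s : ℝ => Complex.exp (-(u * ((Real.pi ^ 2 / v : ℝ) * s))
        - x * Complex.exp (-((Real.pi ^ 2 / v : ℝ) * s)))) (n : ℝ)
      = ((Real.pi ^ 2 / v : ℝ) : ℂ)⁻¹ * Complex.exp (-(u * Complex.log x)) *
        psiTerm u v (Complex.exp (-((2 * v / Real.pi : ℝ) * Complex.I * Complex.log x))) n := by
  have hpi : (Real.pi : ℂ) ≠ 0 := by exact_mod_cast Real.pi_pos.ne'
  have hvc : (v : ℂ) ≠ 0 := by exact_mod_cast hv.ne'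
  set T : ℝ := Real.pi ^ 2 / v with hT
  have hT0 : 0 < T := by positivity
  set a : ℂ := u + 2 * Complex.I * v * n / Real.pi with ha
  have hare : a.re = u.re := by
    rw [ha, show 2 * Complex.I * (v : ℂ) * n / Real.pi
      = ((2 * v * n / Real.pi : ℝ) : ℂ) * Complex.I by push_cast; ring]
    simp
  have h1 := integral_cpow_mul_exp_neg_mul_of_re_pos (a := a) (by rwa [hare]) hx
  have h2 := mellin_eq_integral_exp (fun t => Complex.exp (-(x * t))) a
  rw [mellin] at h2
  simp only [smul_eq_mul] at h2
  rw [h1] at h2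
  have h3 := Measure.integral_comp_mul_left
    (fun y : ℝ => Complex.exp (-(a * y)) * Complex.exp (-(x * (Real.exp (-y) : ℝ)))) T
  rw [← h2, abs_of_pos (inv_pos.2 hT0), Complex.real_smul] at h3
  rw [Real.fourier_real_eq_integral_exp_smul, psiTerm, ← ha]
  calc _ = ∫ s : ℝ, Complex.exp (-(a * (T * s : ℝ))) *
        Complex.exp (-(x * (Real.exp (-(T * s)) : ℝ))) := by
        congr 1
        ext s
        rw [smul_eq_mul, ← Complex.exp_add, ← Complex.exp_add, ha, hT]
        congr 1
        push_cast
        field_simp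
        ring
    _ = _ := by
        rw [h3, ← Complex.exp_int_mul, mul_assoc (_)⁻¹, mul_left_comm _ (Complex.Gamma a),
          ← Complex.exp_add, ha, mul_comm (Complex.exp _) (Complex.Gamma _)]
        push_cast
        congr 3
        ring

/-- Poisson summation turns the Laurent series into the Dirichlet series with frequencies
`exp (T k)`, `T = π² / v`. -/
theorem Psi_eq_tsum_gapTerm {u x : ℂ} {v : ℝ} (hu : 0 < u.re) (hv : 0 < v) (hx : 0 < x.re)
    (hs : Summable (psiTerm u v
      (Complex.exp (-((2 * v / Real.pi : ℝ) * Complex.I * Complex.log x))))) :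
    ∑' k : ℤ, gapTerm u (Real.pi ^ 2 / v) x k
      = ((Real.pi ^ 2 / v : ℝ) : ℂ)⁻¹ * Complex.exp (-(u * Complex.log x)) *
        Psi u v (Complex.exp (-((2 * v / Real.pi : ℝ) * Complex.I * Complex.log x))) := by
  have hF := fourier_gap_eq_psiTerm hu hv hx
  set T : ℝ := Real.pi ^ 2 / v with hT
  have hT0 : 0 < T := by positivity
  set g : ℝ → ℂ := fun s : ℝ => Complex.exp (-(u * (T * s)) - x * Complex.exp (-(T * s))) with hg
  have hc : Continuous g := by fun_prop
  have hgn : ∀ s : ℝ, ‖g s‖ = Real.exp (u.re * (-(T * s)) - x.re * Real.exp (-(T * s))) := by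
    intro s
    have e1 : -(u * ((T : ℂ) * s)) = u * ((-(T * s) : ℝ) : ℂ) := by push_cast; ring
    have e2 : Complex.exp (-((T : ℂ) * s)) = (Real.exp (-(T * s)) : ℝ) := by push_cast; rfl
    rw [hg, Complex.norm_exp, e1, e2, Complex.sub_re, Complex.re_mul_ofReal,
      Complex.re_mul_ofReal]
  obtain ⟨C, hC⟩ := exists_exp_mul_sub_exp_le u.re hx
  have hO : g =O[cocompact ℝ] fun s : ℝ => |s| ^ (-2 : ℝ) := by
    refine Asymptotics.IsBigO.trans ?_ (isBigO_exp_neg_mul_abs_rpow (mul_pos hu hT0) (-2))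
    refine Asymptotics.IsBigO.of_bound C (Eventually.of_forall fun s => ?_)
    rw [hgn, Real.norm_of_nonneg (Real.exp_pos _).le]
    refine (hC _).trans (le_of_eq ?_)
    rw [abs_neg, abs_mul, abs_of_pos hT0, mul_assoc]
  have hsum : Summable fun n : ℤ => 𝓕 g (n : ℝ) := by
    simp_rw [hF]
    exact hs.mul_left _
  -- The real shift in Poisson's formula is already contained in `x`, so it is taken to be `0`.
  have hP := Real.tsum_eq_tsum_fourier_of_rpow_decay_of_summable hc one_lt_two hO hsum 0
  have h0 : ∀ n : ℤ, fourier n ((0 : ℝ) : UnitAddCircle) = (1 : ℂ) := fun n => by simp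
  simp_rw [h0, mul_one, hF, zero_add, tsum_mul_left] at hP
  rw [Psi, ← hP, ← (Equiv.neg ℤ).tsum_eq]
  refine tsum_congr fun k => ?_
  rw [gapTerm, hg]
  simp

/-! ### Convergence and boundary behaviour of the Laurent series -/

/-- On a relatively compact sub-annulus the terms of the series are dominated by a geometric
series. -/
lemma exists_summable_psiTerm_bound {u : ℂ} {v β : ℝ} (hu : 0 < u.re) (hβ0 : 0 ≤ β)
    (hβ : β < v) :
    ∃ b : ℤ → ℝ, Summable b ∧ ∀ (n : ℤ) (z : ℂ),
      Real.exp (-β) < ‖z‖ → ‖z‖ < Real.exp β → ‖psiTerm u v z n‖ ≤ b n := by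
  have hv : 0 < v := hβ0.trans_lt hβ
  have hpi := Real.pi_pos
  -- The rate `α` makes the Gamma factor decay like `exp (-(β + v) |n| / 2)`.
  set α : ℝ := Real.pi * (β + v) / (4 * v) with hα
  have hα0 : 0 ≤ α := by positivity
  have hα1 : α < Real.pi / 2 := by
    rw [hα, div_lt_div_iff₀ (by positivity) two_pos]
    nlinarith
  obtain ⟨C, hC⟩ := exists_norm_Gamma_le_exp hu hα0 hα1
  have hC0 : 0 ≤ C := by
    have := (norm_nonneg _).trans (hC u rfl)
    exact nonneg_of_mul_nonneg_left this (Real.exp_pos _)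
  refine ⟨fun n => C * Real.exp (α * |u.im|) * Real.exp (-((v - β) / 2 * |(n : ℝ)|)),
    (summable_exp_neg_mul_abs_int (by linarith)).mul_left _, fun n z hz1 hz2 => ?_⟩
  set t : ℝ := 2 * v * n / Real.pi with ht
  have ha : u + 2 * Complex.I * (v : ℂ) * n / Real.pi = u + (t : ℂ) * Complex.I := by
    rw [ht]; push_cast; ring
  have hΓ : ‖Complex.Gamma (u + t * Complex.I)‖ ≤ C * Real.exp (-(α * |u.im + t|)) := by
    have := hC (u + t * Complex.I) (by simp)
    simpa using this
  have hz0 : 0 < ‖z‖ := (Real.exp_pos _).trans hz1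
  have hzn : ‖z ^ n‖ ≤ Real.exp (β * |(n : ℝ)|) := by
    rw [norm_zpow, ← Real.rpow_intCast, Real.rpow_def_of_pos hz0]
    apply Real.exp_le_exp.2
    have h1 : |Real.log ‖z‖| ≤ β := by
      rw [abs_le]
      exact ⟨((Real.lt_log_iff_exp_lt hz0).2 hz1).le, ((Real.log_lt_iff_lt_exp hz0).2 hz2).le⟩
    calc Real.log ‖z‖ * n ≤ |Real.log ‖z‖ * n| := le_abs_self _
      _ = |Real.log ‖z‖| * |(n : ℝ)| := abs_mul _ _
      _ ≤ _ := by gcongr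
  have habs : |t| - |u.im| ≤ |u.im + t| := by
    have := abs_sub_abs_le_abs_sub t (-u.im)
    rwa [abs_neg, sub_neg_eq_add, add_comm t] at this
  have hαt : α * |t| = (β + v) / 2 * |(n : ℝ)| := by
    rw [ht, hα, abs_div, abs_mul, abs_of_pos hpi, abs_of_pos (by positivity : 0 < 2 * v)]
    field_simp
    ring
  rw [psiTerm, ha, norm_mul]
  calc _ ≤ C * Real.exp (-(α * |u.im + t|)) * Real.exp (β * |(n : ℝ)|) := by gcongr
    _ = C * Real.exp (-(α * |u.im + t|) + β * |(n : ℝ)|) := by rw [mul_assoc, Real.exp_add]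
    _ ≤ C * Real.exp (α * |u.im| + -((v - β) / 2 * |(n : ℝ)|)) := by
      refine mul_le_mul_of_nonneg_left (Real.exp_le_exp.2 ?_) hC0
      have := mul_le_mul_of_nonneg_left habs hα0
      rw [mul_sub, hαt] at this
      linarith
    _ = _ := by rw [Real.exp_add, ← mul_assoc]

lemma exists_sub_annulus {v : ℝ} (hv : 0 < v) {z : ℂ} (hz : z ∈ annulusC v) :
    ∃ β, 0 ≤ β ∧ β < v ∧ Real.exp (-β) < ‖z‖ ∧ ‖z‖ < Real.exp β := by
  obtain ⟨h1, h2⟩ := hz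
  rw [abs_of_pos hv] at h1 h2
  have hz0 : 0 < ‖z‖ := (Real.exp_pos _).trans h1
  rw [← Real.lt_log_iff_exp_lt hz0] at h1
  rw [← Real.log_lt_iff_lt_exp hz0] at h2
  obtain ⟨β, hβ1, hβ2⟩ := exists_between (abs_lt.2 ⟨h1, h2⟩)
  have h3 := abs_lt.1 hβ1
  exact ⟨β, (abs_nonneg _).trans hβ1.le, hβ2, (Real.lt_log_iff_exp_lt hz0).1 h3.1,
    (Real.log_lt_iff_lt_exp hz0).1 h3.2⟩

lemma summable_psiTerm {u : ℂ} {v : ℝ} (hu : 0 < u.re) (hv : 0 < v) {z : ℂ}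
    (hz : z ∈ annulusC v) : Summable (psiTerm u v z) := by
  obtain ⟨β, hβ0, hβ, h1, h2⟩ := exists_sub_annulus hv hz
  obtain ⟨b, hb, hle⟩ := exists_summable_psiTerm_bound hu hβ0 hβ
  exact hb.of_norm_bounded fun n => hle n z h1 h2

lemma analyticOnNhd_Psi {u : ℂ} {v : ℝ} (hu : 0 < u.re) (hv : 0 < v) :
    AnalyticOnNhd ℂ (Psi u v) (annulusC v) := by
  intro z hz
  obtain ⟨β, hβ0, hβ, h1, h2⟩ := exists_sub_annulus hv hz
  obtain ⟨b, hb, hle⟩ := exists_summable_psiTerm_bound hu hβ0 hβ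
  have hopen : IsOpen {w : ℂ | Real.exp (-β) < ‖w‖ ∧ ‖w‖ < Real.exp β} :=
    (isOpen_lt continuous_const continuous_norm).inter (isOpen_lt continuous_norm continuous_const)
  have hd := Complex.differentiableOn_tsum_of_summable_norm (F := fun n w => psiTerm u v w n) hb
    (fun n w hw => ?_) hopen (fun n w hw => hle n w hw.1 hw.2)
  · exact hd.analyticOnNhd hopen z ⟨h1, h2⟩
  · have hw0 : w ≠ 0 := norm_pos_iff.1 ((Real.exp_pos _).trans hw.1)
    exact ((differentiableAt_zpow.2 (Or.inl hw0)).const_mul _).differentiableWithinAt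

lemma exp_log_mem_annulusC {v : ℝ} (hv : 0 < v) {x : ℂ} (hx : 0 < x.re) :
    Complex.exp (-((2 * v / Real.pi : ℝ) * Complex.I * Complex.log x)) ∈ annulusC v := by
  have hpi := Real.pi_pos
  have h := abs_lt.1 (Complex.abs_arg_lt_pi_div_two_iff.2 (Or.inl hx))
  have hn : ‖Complex.exp (-((2 * v / Real.pi : ℝ) * Complex.I * Complex.log x))‖
      = Real.exp (2 * v / Real.pi * x.arg) := by
    rw [Complex.norm_exp, mul_assoc, Complex.neg_re, Complex.re_ofReal_mul, Complex.I_mul_re,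
      Complex.log_im]
    congr 1
    ring
  have hc : 0 < 2 * v / Real.pi := by positivity
  have hv' : v = 2 * v / Real.pi * (Real.pi / 2) := by field_simp
  refine ⟨?_, ?_⟩ <;> rw [hn, abs_of_pos hv] <;> apply Real.exp_lt_exp.2
  · have := mul_lt_mul_of_pos_left h.1 hc
    linarith
  · have := mul_lt_mul_of_pos_left h.2 hc
    linarith

lemma abs_log_norm_of_mem_frontier_annulusC {v : ℝ} (hv : 0 < v) {z : ℂ}
    (hz : z ∈ frontier (annulusC v)) : |Real.log ‖z‖| = v := by
  have h1 : ‖z‖ ∈ frontier (Set.Ioo (Real.exp (-|v|)) (Real.exp |v|)) :=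
    continuous_norm.frontier_preimage_subset _ hz
  rw [abs_of_pos hv, frontier_Ioo (Real.exp_lt_exp.2 (by linarith))] at h1
  rcases h1 with h | h
  · rw [h, Real.log_exp, abs_neg, abs_of_pos hv]
  · rw [Set.mem_singleton_iff.1 h, Real.log_exp, abs_of_pos hv]

/-- The map `x ↦ exp (-(2v/π) i log x)` of the right half-plane onto the annulus extends
continuously to the punctured imaginary axis, which it sends onto the boundary circles. -/
lemma exists_imaginary_preimage {v : ℝ} (hv : 0 < v) {z : ℂ} (hz : z ∈ frontier (annulusC v)) :
    ∃ y : ℝ, (y * Complex.I : ℂ) ∈ Complex.slitPlane ∧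
      Complex.exp (-((2 * v / Real.pi : ℝ) * Complex.I * Complex.log (y * Complex.I))) = z := by
  have hpi := Real.pi_pos
  have hpic : (Real.pi : ℂ) ≠ 0 := by exact_mod_cast hpi.ne'
  have hvc : (v : ℂ) ≠ 0 := by exact_mod_cast hv.ne'
  have hlog := abs_log_norm_of_mem_frontier_annulusC hv hz
  have hz0 : z ≠ 0 := by
    rintro rfl
    simp at hlog
    exact hv.ne hlog
  set w : ℂ := ((Real.pi / (2 * v) : ℝ) : ℂ) * (Complex.I * Complex.log z) with hw
  have him : |w.im| = Real.pi / 2 := by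
    rw [hw, Complex.im_ofReal_mul, Complex.I_mul_im, Complex.log_re, abs_mul, hlog,
      abs_of_pos (by positivity)]
    field_simp
  have hcos : Real.cos w.im = 0 := by rw [← Real.cos_abs, him, Real.cos_pi_div_two]
  have hre : (Complex.exp w).re = 0 := by rw [Complex.exp_re, hcos, mul_zero]
  have hx : (((Complex.exp w).im : ℝ) : ℂ) * Complex.I = Complex.exp w := by
    apply Complex.ext <;> simp [hre]
  have hb := abs_le.1 him.le
  refine ⟨(Complex.exp w).im, ?_, ?_⟩
  · rw [hx, Complex.mem_slitPlane_iff]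
    refine Or.inr fun h => Complex.exp_ne_zero w (Complex.ext hre h)
  · rw [hx, Complex.log_exp (by linarith) (by linarith), hw]
    rw [show -(((2 * v / Real.pi : ℝ) : ℂ) * Complex.I *
        (((Real.pi / (2 * v) : ℝ) : ℂ) * (Complex.I * Complex.log z)))
        = -(Complex.I * Complex.I) * Complex.log z by push_cast; field_simp]
    rw [Complex.I_mul_I, neg_neg, one_mul, Complex.exp_log hz0]

theorem not_extendsAnalyticallyAt_Psi {u : ℂ} {v : ℝ} (hu : 0 < u.re) (hv : 0 < v) {z₀ : ℂ}
    (hz₀ : z₀ ∈ frontier (annulusC v)) :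
    ¬ ExtendsAnalyticallyAt (Psi u v) (annulusC v) z₀ := by
  rintro ⟨U, hU, hzU, g, hg, hgΨ⟩
  obtain ⟨y, hslit, hy⟩ := exists_imaginary_preimage hv hz₀
  have hE : ContinuousAt (fun x : ℂ =>
      Complex.exp (-((2 * v / Real.pi : ℝ) * Complex.I * Complex.log x))) (y * Complex.I) := by
    have := continuousAt_clog hslit
    fun_prop
  have hg0 : ContinuousAt (fun x : ℂ =>
      g (Complex.exp (-((2 * v / Real.pi : ℝ) * Complex.I * Complex.log x)))) (y * Complex.I) :=
    ContinuousAt.comp (g := g) (by rw [hy]; exact (hg z₀ hzU).continuousAt) hE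
  have hΦ : ContinuousAt (fun x : ℂ => ((Real.pi ^ 2 / v : ℝ) : ℂ)⁻¹ *
      Complex.exp (-(u * Complex.log x)) *
      g (Complex.exp (-((2 * v / Real.pi : ℝ) * Complex.I * Complex.log x)))) (y * Complex.I) := by
    have := continuousAt_clog hslit
    exact ContinuousAt.mul (by fun_prop) hg0
  have hUx : ∀ᶠ x in 𝓝 (y * Complex.I : ℂ),
      Complex.exp (-((2 * v / Real.pi : ℝ) * Complex.I * Complex.log x)) ∈ U :=
    hE.preimage_mem_nhds (hU.mem_nhds (by simpa only [hy] using hzU))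
  obtain ⟨M, hM⟩ : ∃ M : ℝ, ∀ᶠ x in 𝓝 (y * Complex.I : ℂ), ‖((Real.pi ^ 2 / v : ℝ) : ℂ)⁻¹ *
      Complex.exp (-(u * Complex.log x)) *
      g (Complex.exp (-((2 * v / Real.pi : ℝ) * Complex.I * Complex.log x)))‖ ≤ M :=
    ⟨_, hΦ.norm.eventually (ge_mem_nhds (lt_add_one _))⟩
  -- An extension across `z₀` would bound the Dirichlet series near the point above `z₀`.
  refine not_eventually_norm_tsum_gapTerm_le hu (T := Real.pi ^ 2 / v) (by positivity) y M ?_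
  filter_upwards [hUx, hM] with x hx1 hx2 hxre
  have hmem := exp_log_mem_annulusC hv hxre
  rw [Psi_eq_tsum_gapTerm hu hv hxre (summable_psiTerm hu hv hmem), ← hgΨ ⟨hx1, hmem⟩]
  exact hx2

theorem mainTheorem1 (u : ℂ) (v : ℝ) (hu : 0 < u.re) (hv : 0 < v) :
    (∀ z ∈ annulusC v, Summable (psiTerm u v z)) ∧
      HasNaturalBoundary (Psi u v) (annulusC v) :=
  ⟨fun _ hz => summable_psiTerm hu hv hz, analyticOnNhd_Psi hu hv,
    fun _ hz => not_extendsAnalyticallyAt_Psi hu hv hz⟩
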